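/- **Theorem (generalization with metric margin).** *Setting.* Let $K\ge 2$, $n\ge 1$, and let $S=((x_1,y_1),\dots,(x_n,y_n))$ be an i.i.d. sample from a probability measure $P$ on $\mathbb R^D\times\{1,\dots,K\}$. Let $d(x,w)\ge 0$ be a distance function (neither symmetry nor the triangle inequality is required), let $\Theta\subseteq\mathbb R^D$ be the set of admissible prototypes and $X\subseteq\mathbb R^D$ a set containing the inputs $P$-almost surely. For prototypes $W=(w_1,\dots,w_K)\in\Theta^K$ and a strictly decreasing link $\kappa:[0,\infty)\to[0,\infty]$ put $$p_k(x)=\frac{\kappa(d(x,w_k))}{\sum_{j=1}^K\kappa(d(x,w_j))},\qquad h_W(x)\in\arg\max_k p_k(x),\qquad \mathcal L(W)=-\sum_{i=1}^n\log p_{y_i}(x_i)$$ (ties in $\arg\max$ are broken arbitrarily; if some weights $\kappa(d(x,w_k))$ are infinite, the probability mass is shared equally by these classes), so that $h_W$ is the nearest-prototype classifier. The distance margin on the sample is $$\gamma(W)=\min_i\Big[\min_{j\ne y_i}d(x_i,w_j)-d(x_i,w_{y_i})\Big].$$ Let $H$ be an inducing space of $d$: a separable real Hilbert space with a measurable map $\varphi:\mathbb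 R^D\to H$ and a map $\psi:\mathbb R^D\to H$ such that, for some real functions $a,b$, $$d(x,w)=a(x)+b(w)-2\langle\varphi(x),\psi(w)\rangle_H\qquad(x\in X,\ w\in\Theta).$$ (Examples: $\varphi=\psi=\mathrm{id}$ for the squared Euclidean distance, $\varphi=\psi=\Sigma^{-1/2}$ for the squared Mahalanobis distance, $\varphi=\mathrm{id}$ and $\psi=\tfrac12\nabla F$ for the Bregman divergence of $F$, normalization to the unit sphere for the cosine distance, and $\varphi=\psi$ with $d(x,w)=\|\varphi(x)-\varphi(w)\|_H^2$ for the Euclidean distance.) The capacity of $W$ is the Frobenius norm of the prototypes in the inducing space, $\|W\|_\star=\big(\sum_{k=1}^K\|\psi(w_k)\|_H^2\big)^{1/2}$. *Claim.* For every $K\ge2$ there is a constant $C>0$, depending only on $K$, such that the following holds for all $D,d,X,\Theta,H,\varphi,\psi,P,n$ as above and all $0<\delta\le 1/2$. Assume the data lie in a ball of radius $R$ of the inducing space, i.e. for some $c\in H$ one has $\|\varphi(x)-c\|_H\le R$ for $P$-almost every $(x,y)$. 1. For every strictly decreasing link $\kappa$, with probability at least $1-\delta$ over $S$, simultaneously for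 all $W\in\Theta^K$ with $\gamma(W)>0$ and all versions of $h_W$, $$\Pr_{(x,y)\sim P}\big[h_W(x)\ne y\big]\;\le\; C\left(\frac{R\,\|W\|_\star}{\gamma(W)\sqrt n}+\sqrt{\frac{\log(1/\delta)}{n}}\right).$$ 2. For the harmonic link $\kappa(r)=r^{-\omega}$, $\omega>0$ (with $\kappa(0)=\infty$), with probability at least $1-\delta$ over $S$, every global minimizer $W\in\Theta^K$ of $\mathcal L$ over $\Theta^K$ with $\gamma(W)>0$ (the prototypes of a minimizer being points of $\mathbb R^D$, i.e. finite) satisfies the inequality of part 1, and its right-hand side is finite. -/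

import Mathlib

open MeasureTheory
open scoped NNReal ENNReal

namespace PrototypeLayer

/-- A training set: `n` pairs (input, label). -/
abbrev Sample (E : Type*) (K n : ℕ) := Fin n → E × Fin K

/-- Unnormalised class weight `κ(d(x, w_k))` of class `k` at the point `x`. -/
def score {E : Type*} {K : ℕ} (d : E → E → ℝ≥0) (κ : ℝ≥0 → ℝ≥0∞) (W : Fin K → E)
    (x : E) (k : Fin K) : ℝ≥0∞ :=
  κ (d x (W k))

open Classical in
/-- Class probabilities `p_k(x) = κ(d(x, w_k)) / ∑_j κ(d(x, w_j))`.
The link may take the value `∞` (for the harmonic link this happens exactly at distance `0`);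
if some class weights are infinite, then the mass is shared equally by these classes. -/
noncomputable def classProb {E : Type*} {K : ℕ} (d : E → E → ℝ≥0) (κ : ℝ≥0 → ℝ≥0∞)
    (W : Fin K → E) (x : E) (k : Fin K) : ℝ≥0∞ :=
  if score d κ W x k = ⊤ then
    ((Finset.univ.filter fun j => score d κ W x j = ⊤).card : ℝ≥0∞)⁻¹
  else score d κ W x k / ∑ j, score d κ W x j

/-- `h` is a version of the classifier `h_W(x) = argmax_k p_k(x)` (ties broken in any way). -/
def IsClassifier {E : Type*} {K : ℕ} (d : E → E → ℝ≥0) (κ : ℝ≥0 → ℝ≥0∞)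
    (W : Fin K → E) (h : E → Fin K) : Prop :=
  ∀ x j, classProb d κ W x j ≤ classProb d κ W x (h x)

/-- Misclassification probability `Pr_{(x,y) ∼ P}[h(x) ≠ y]`. -/
noncomputable def errorProb {E : Type*} [MeasurableSpace E] {K : ℕ}
    (P : Measure (E × Fin K)) (h : E → Fin K) : ℝ≥0∞ :=
  P {z | h z.1 ≠ z.2}

/-- The empirical loss `-∑_i log p_{y_i}(x_i)`, with values in `[0, ∞]`. -/
noncomputable def empiricalLoss {E : Type*} {K n : ℕ} (d : E → E → ℝ≥0) (κ : ℝ≥0 → ℝ≥0∞)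
    (S : Sample E K n) (W : Fin K → E) : EReal :=
  ∑ i, -ENNReal.log (classProb d κ W (S i).1 (S i).2)

/-- The harmonic link `κ(r) = r^{-ω}`, with `κ(0) = ∞`. -/
noncomputable def harmonicLink (ω : ℝ) (r : ℝ≥0) : ℝ≥0∞ := (r : ℝ≥0∞) ^ (-ω)

/-- The distance margin
`γ(W) = min_i [min_{j ≠ y_i} d(x_i, w_j) - d(x_i, w_{y_i})]` on the training set `S`. -/
noncomputable def margin {E : Type*} {K n : ℕ} (d : E → E → ℝ≥0) (S : Sample E K n)
    (W : Fin K → E) : ℝ :=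
  ⨅ i : Fin n, ((⨅ j : {j : Fin K // j ≠ (S i).2}, (d (S i).1 (W j) : ℝ))
    - (d (S i).1 (W (S i).2) : ℝ))

/-- `H`, with the maps `φ` on inputs and `ψ` on prototypes, is an inducing space of `d` on
`X × Θ`: `d(x, w) = a(x) + b(w) - 2 ⟪φ(x), ψ(w)⟫` for `x ∈ X`, `w ∈ Θ` and some functions
`a`, `b`. For `ψ = φ`, `a = b = ‖φ‖²` this says `d(x, w) = ‖φ(x) - φ(w)‖²`. -/
def IsInducedBy {E H : Type*} [NormedAddCommGroup H] [InnerProductSpace ℝ H]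
    (d : E → E → ℝ≥0) (X Θ : Set E) (φ ψ : E → H) : Prop :=
  ∃ a b : E → ℝ, ∀ x ∈ X, ∀ w ∈ Θ, (d x w : ℝ) = a x + b w - 2 * inner ℝ (φ x) (ψ w)

/-- The capacity `‖W‖_⋆`: the Frobenius norm of the prototypes in the inducing space. -/
noncomputable def capacity {E H : Type*} [NormedAddCommGroup H] {K : ℕ} (ψ : E → H)
    (W : Fin K → E) : ℝ :=
  √(∑ k, ‖ψ (W k)‖ ^ 2)

/-- The margin bound `C (R ‖W‖_⋆ / (γ √n) + √(log (1/δ) / n))`, as an element of `[0, ∞]`. -/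
noncomputable def marginBound (C R N γ : ℝ) (n : ℕ) (δ : ℝ) : ℝ≥0∞ :=
  ENNReal.ofReal C *
    (ENNReal.ofReal (R * N) / ENNReal.ofReal (γ * √(n : ℝ))
      + ENNReal.ofReal (√(Real.log (1 / δ) / (n : ℝ))))

end PrototypeLayer

open PrototypeLayer

/-! In a difference `d(x, w_j) - d(x, w_y)` the term `a(x)` cancels, so after division by the margin
`γ` it is an affine functional of `φ(x) - c`. It is at least `1` on the sample points of class `y`
and at most `0` wherever a point of class `y` is assigned to `j`, and `R` times the norm of its
linear part is at most `4x` with `x = R‖W‖_⋆/γ`. It therefore suffices to bound, for each class, the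
probability that such a functional is nonpositive, and to sum over the pairs `(y, j)`.

Swapping with a ghost sample reduces this to counting patterns on `2n` points
(`pi_exists_consistent_mul_le`). A greedy argument replaces the linear part by a sum of about `x²`
signed steps along the points (`exists_signedSum_approx`), and the offset matters only through its
position among the values, so it may be unbounded. The order of the steps is irrelevant: counting
multisets gives `exp(O(√(mn)))` patterns (`choose_le_exp_sqrt`), hence error `√(m/n)` with no
logarithmic factor in `n`. A union bound with weights `2^{-m}` makes the estimate uniform in the
capacity and the margin. -/

namespace PrototypeLayer

/-! ### Symmetrization by random swaps. -/

/-- The map on `n` pairs that swaps the entries of the pairs selected by `σ`. -/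
def swapPairs {Z : Type*} {n : ℕ} (σ : Fin n → Bool) (z : Fin n → Z × Z) : Fin n → Z × Z :=
  fun k => if σ k then (z k).swap else z k

theorem measurePreserving_swapPairs {Z : Type*} [MeasurableSpace Z] (P : Measure Z)
    [IsProbabilityMeasure P] {n : ℕ} (σ : Fin n → Bool) :
    MeasurePreserving (swapPairs (Z := Z) σ) (Measure.pi fun _ : Fin n => P.prod P)
      (Measure.pi fun _ : Fin n => P.prod P) := by
  have h := measurePreserving_pi (fun _ : Fin n => P.prod P) (fun _ : Fin n => P.prod P)
    (f := fun k p => if σ k then p.swap else p) (fun k => by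
      cases σ k
      · exact MeasurePreserving.id (P.prod P)
      · simpa using Measure.measurePreserving_swap (μ := P) (ν := P))
  exact h

theorem lintegral_pi_prod {Z : Type*} [MeasurableSpace Z] (P : Measure Z)
    [IsProbabilityMeasure P] {n : ℕ} {f : Z → ℝ≥0∞} (hf : Measurable f) :
    ∫⁻ S, ∏ k : Fin n, f (S k) ∂(Measure.pi fun _ : Fin n => P) = (∫⁻ x, f x ∂P) ^ n := by
  rw [ProbabilityTheory.lintegral_prod_eq_prod_lintegral_of_indepFun Finset.univ
    (fun (k : Fin n) (S : Fin n → Z) => f (S k))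
    (ProbabilityTheory.iIndepFun_pi (X := fun _ => f) fun _ => hf.aemeasurable)
    (fun k => hf.comp (measurable_pi_apply k))]
  simp [(measurePreserving_eval (fun _ : Fin n => P) _).lintegral_comp hf]

open Classical in
/-- For a fixed pattern `T` on `n` pairs, the average over all swaps of the weight that vanishes
if some first entry lies in `T`, and otherwise is `2` to the number of second entries in `T`,
is at most one. -/
theorem sum_swap_weight_le {n : ℕ} (T : Set (Fin n × Bool)) :
    ∑ σ : Fin n → Bool, ∏ k, ((if (k, σ k) ∈ T then 0 else 1) *
      (if (k, !σ k) ∈ T then 2 else 1) : ℝ≥0∞) ≤ 2 ^ n := by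
  have h := Finset.prod_univ_sum (ι := Fin n) (κ := fun _ => Bool) (R := ℝ≥0∞)
    (fun _ => Finset.univ)
    (fun k b => (if (k, b) ∈ T then 0 else 1) * (if (k, !b) ∈ T then 2 else 1))
  rw [Fintype.piFinset_univ] at h
  rw [← h]
  calc _ ≤ ∏ _k : Fin n, (2 : ℝ≥0∞) := by
        refine Finset.prod_le_prod' fun k _ => ?_
        -- With both entries in `T` both orders give 0; with exactly one, the orders give 0 and 2;
        -- with none, both give 1.
        by_cases h1 : (k, true) ∈ T <;> by_cases h2 : (k, false) ∈ T <;> simp [h1, h2]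
        norm_num
    _ = 2 ^ n := by simp

open Classical in
theorem indicator_one_le_ite {α : Type*} {s : Set α} {a : α} {p : Prop} (h : a ∈ s → ¬p) :
    s.indicator (1 : α → ℝ≥0∞) a ≤ if p then 0 else 1 := by
  by_cases ha : a ∈ s
  · simp [ha, h ha]
  · simp [ha]

open Classical in
theorem one_add_indicator_le_ite {α : Type*} {s : Set α} {a : α} {p : Prop} (h : a ∈ s → p) :
    1 + s.indicator (1 : α → ℝ≥0∞) a ≤ if p then 2 else 1 := by
  by_cases ha : a ∈ s
  · simp [ha, h ha, one_add_one_eq_two]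
  · rw [Set.indicator_of_notMem ha, add_zero]
    split_ifs <;> norm_num

open Classical in
/-- Uniform deviation bound for consistent hypotheses: if on every double sample the pairs
`(B i, C i)` of error and consistency regions are separated by at most `N` patterns, then it is
unlikely that a sample lies in some `C i` whose error region `B i` has probability at least `ε`. -/
theorem pi_exists_consistent_mul_le {Z : Type*} [MeasurableSpace Z] (P : Measure Z)
    [IsProbabilityMeasure P] {ι : Type*} [Countable ι] {n : ℕ} (B C : ι → Set Z)
    (hB : ∀ i, MeasurableSet (B i)) (hC : ∀ i, MeasurableSet (C i)) (N : ℕ)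
    (hcover : ∀ z : Fin n × Bool → Z, ∃ 𝒯 : Finset (Set (Fin n × Bool)), 𝒯.card ≤ N ∧
      ∀ i, ∃ T ∈ 𝒯, ∀ k, (z k ∈ B i → k ∈ T) ∧ (z k ∈ C i → k ∉ T)) (ε : ℝ≥0∞) :
    (1 + ε) ^ n * Measure.pi (fun _ : Fin n => P) {S | ∃ i, ε ≤ P (B i) ∧ ∀ k, S k ∈ C i} ≤ N := by
  set μ := Measure.pi (fun _ : Fin n => P) with hμ
  -- On a bad sample, integrating the product for the offending `i` over the ghost sample gives `(1
  -- + P(B i))^n ≥ (1 + ε)^n`. Markov's inequality then leaves only the mean of `F`, which is at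
  -- most `N` by averaging over swaps.
  set F : (Fin n → Z × Z) → ℝ≥0∞ := fun z => ⨆ i, ∏ k,
    ((C i).indicator 1 (z k).1 * (1 + (B i).indicator 1 (z k).2)) with hF
  have hFm : Measurable F := by
    refine Measurable.iSup fun i => Finset.measurable_prod _ fun k _ => ?_
    have h1 : Measurable ((C i).indicator (1 : Z → ℝ≥0∞)) := measurable_one.indicator (hC i)
    have h2 : Measurable ((B i).indicator (1 : Z → ℝ≥0∞)) := measurable_one.indicator (hB i)
    fun_prop
  have hjoint : ∫⁻ S, ∫⁻ S', F (fun k => (S k, S' k)) ∂μ ∂μ =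
      ∫⁻ z, F z ∂(Measure.pi fun _ : Fin n => P.prod P) := by
    have hmp := measurePreserving_arrowProdEquivProdArrow Z Z (Fin n) (fun _ => P) (fun _ => P)
    have hsymm := hmp.symm
    rw [← hsymm.lintegral_comp hFm, lintegral_prod]
    · rfl
    · exact (hFm.comp hsymm.measurable).aemeasurable
  have hsub : {S : Fin n → Z | ∃ i, ε ≤ P (B i) ∧ ∀ k, S k ∈ C i} ⊆
      {S | (1 + ε) ^ n ≤ ∫⁻ S', F (fun k => (S k, S' k)) ∂μ} := by
    rintro S ⟨i, hi, hS⟩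
    have h1 : (1 + P (B i)) ^ n = ∫⁻ S', ∏ k : Fin n, (1 + (B i).indicator 1 (S' k)) ∂μ := by
      have hm : Measurable fun x => (1 + (B i).indicator (1 : Z → ℝ≥0∞) x) :=
        Measurable.const_add (measurable_one.indicator (hB i)) 1
      rw [lintegral_pi_prod P hm, lintegral_add_left measurable_const,
        lintegral_indicator_one (hB i)]
      simp
    change (1 + ε) ^ n ≤ _
    calc (1 + ε) ^ n ≤ (1 + P (B i)) ^ n := by gcongr
      _ = _ := h1
      _ ≤ _ := by
        refine lintegral_mono fun S' => ?_
        refine le_trans (le_of_eq ?_) (le_iSup _ i)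
        exact Finset.prod_congr rfl fun k _ => by simp [hS k]
  have hswap : (2 : ℝ≥0∞) ^ n * ∫⁻ z, F z ∂(Measure.pi fun _ : Fin n => P.prod P) ≤ 2 ^ n * N := by
    calc (2 : ℝ≥0∞) ^ n * ∫⁻ z, F z ∂(Measure.pi fun _ : Fin n => P.prod P)
        = ∑ σ : Fin n → Bool, ∫⁻ z, F (swapPairs σ z) ∂(Measure.pi fun _ : Fin n => P.prod P) := by
          simp_rw [(measurePreserving_swapPairs P _).lintegral_comp hFm]
          simp
      _ = ∫⁻ z, ∑ σ : Fin n → Bool, F (swapPairs σ z) ∂(Measure.pi fun _ : Fin n => P.prod P) :=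
          (lintegral_finsetSum _ fun σ _ =>
            hFm.comp (measurePreserving_swapPairs P σ).measurable).symm
      _ ≤ ∫⁻ _, 2 ^ n * N ∂(Measure.pi fun _ : Fin n => P.prod P) := by
          refine lintegral_mono fun z => ?_
          obtain ⟨𝒯, hcard, h𝒯⟩ := hcover fun p => if p.2 then (z p.1).2 else (z p.1).1
          calc ∑ σ : Fin n → Bool, F (swapPairs σ z)
              ≤ ∑ σ : Fin n → Bool, ∑ T ∈ 𝒯, ∏ k, ((if (k, σ k) ∈ T then 0 else 1) *
                  (if (k, !σ k) ∈ T then 2 else 1) : ℝ≥0∞) := by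
                refine Finset.sum_le_sum fun σ _ => iSup_le fun i => ?_
                obtain ⟨T, hT, h⟩ := h𝒯 i
                refine le_trans ?_ (Finset.single_le_sum (f := fun T => ∏ k,
                  ((if (k, σ k) ∈ T then 0 else 1) * (if (k, !σ k) ∈ T then 2 else 1) : ℝ≥0∞))
                  (fun _ _ => zero_le) hT)
                refine Finset.prod_le_prod' fun k _ => mul_le_mul' ?_ ?_
                · refine indicator_one_le_ite fun hk => (h (k, σ k)).2 ?_
                  cases hσ : σ k <;> simpa [hσ, swapPairs] using hk
                · refine one_add_indicator_le_ite fun hk => (h (k, !σ k)).1 ?_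
                  cases hσ : σ k <;> simpa [hσ, swapPairs] using hk
            _ = ∑ T ∈ 𝒯, ∑ σ : Fin n → Bool, ∏ k, ((if (k, σ k) ∈ T then 0 else 1) *
                  (if (k, !σ k) ∈ T then 2 else 1) : ℝ≥0∞) := Finset.sum_comm
            _ ≤ ∑ T ∈ 𝒯, 2 ^ n := Finset.sum_le_sum fun T _ => sum_swap_weight_le T
            _ ≤ 2 ^ n * N := by
                rw [Finset.sum_const, nsmul_eq_mul, mul_comm]
                gcongr
      _ = 2 ^ n * N := by simp
  calc (1 + ε) ^ n * μ {S | ∃ i, ε ≤ P (B i) ∧ ∀ k, S k ∈ C i}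
      ≤ (1 + ε) ^ n * μ {S | (1 + ε) ^ n ≤ ∫⁻ S', F (fun k => (S k, S' k)) ∂μ} := by
        gcongr
    _ ≤ ∫⁻ S, ∫⁻ S', F (fun k => (S k, S' k)) ∂μ ∂μ := by
        refine mul_meas_ge_le_lintegral (Measurable.lintegral_prod_right'
          (f := fun p : (Fin n → Z) × (Fin n → Z) => F fun k => (p.1 k, p.2 k)) ?_) _
        exact hFm.comp (by fun_prop)
    _ = _ := hjoint
    _ ≤ N := (ENNReal.mul_le_mul_iff_right (by simp) (by simp)).1 hswap

/-! ### Counting patterns of affine functionals by greedy approximation. -/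

section Cover

variable {κ H : Type*} [NormedAddCommGroup H] [InnerProductSpace ℝ H]

/-- The increment `± η z k` encoded by `some (k, ±)`; `none` encodes the zero increment. -/
def signedStep (η : ℝ) (z : κ → H) : Option (κ × Bool) → H
  | none => 0
  | some (k, true) => η • z k
  | some (k, false) => -(η • z k)

/-- The sum of the increments in a multiset. -/
def signedSum (η : ℝ) (z : κ → H) {m : ℕ} (M : Sym (Option (κ × Bool)) m) : H :=
  ((M : Multiset (Option (κ × Bool))).map (signedStep η z)).sum

/-- Greedy approximation: a vector of norm at most `V` is approximated to accuracy `τ` on points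
of norm at most `R` by a sum of at most `m` signed steps along these points, if
`R² V² ≤ m τ²`. -/
theorem exists_signedSum_approx (z : κ → H) {R τ : ℝ} (hτ : 0 ≤ τ) (hz : ∀ k, ‖z k‖ ≤ R)
    (m : ℕ) (v : H) (hv : R ^ 2 * ‖v‖ ^ 2 ≤ m * τ ^ 2) :
    ∃ M : Sym (Option (κ × Bool)) m, ∀ k, |inner ℝ (v - signedSum (τ / R ^ 2) z M) (z k)| ≤ τ := by
  induction m generalizing v with
  | zero =>
    refine ⟨Sym.nil, fun k => ?_⟩
    have hR : 0 ≤ R := (norm_nonneg _).trans (hz k)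
    have h0 : R * ‖v‖ = 0 := by
      have : (R * ‖v‖) ^ 2 ≤ 0 := by simpa [mul_pow] using hv
      exact pow_eq_zero_iff (two_ne_zero) |>.1 (le_antisymm this (sq_nonneg _))
    have h1 : signedSum (τ / R ^ 2) z (Sym.nil : Sym (Option (κ × Bool)) 0) = 0 := rfl
    rw [h1, sub_zero]
    calc _ ≤ ‖v‖ * ‖z k‖ := abs_real_inner_le_norm _ _
      _ ≤ ‖v‖ * R := by gcongr; exact hz k
      _ = 0 := by rw [mul_comm, h0]
      _ ≤ τ := hτ
  | succ m ih =>
    by_cases hall : ∀ k, |inner ℝ v (z k)| ≤ τ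
    -- Zero increments pad the multiset to the prescribed size.
    · refine ⟨Sym.replicate (m + 1) none, fun k => ?_⟩
      have h1 : signedSum (τ / R ^ 2) z (Sym.replicate (m + 1) none) = 0 := by
        rw [signedSum, Sym.coe_replicate, Multiset.map_replicate, Multiset.sum_replicate]
        exact smul_zero _
      rw [h1, sub_zero]
      exact hall k
    · push Not at hall
      obtain ⟨k, hk⟩ := hall
      have hR : 0 < R := by
        rcases (norm_nonneg (z k)).eq_or_lt with h | h
        · rw [eq_comm, norm_eq_zero] at h
          simp [h] at hk
          exact absurd hτ (not_le.2 hk)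
        · exact h.trans_le (hz k)
      have hη : 0 ≤ τ / R ^ 2 := by positivity
      have hz2 : ‖z k‖ ^ 2 ≤ R ^ 2 := by gcongr; exact hz k
      obtain ⟨b, hb⟩ : ∃ b : Bool, ‖v - signedStep (τ / R ^ 2) z (some (k, b))‖ ^ 2 =
          ‖v‖ ^ 2 - 2 * (τ / R ^ 2 * |inner ℝ v (z k)|) + (τ / R ^ 2) ^ 2 * ‖z k‖ ^ 2 := by
        rcases le_total 0 (inner ℝ v (z k)) with h | h
        · refine ⟨true, ?_⟩
          simp only [signedStep]
          rw [norm_sub_sq_real, inner_smul_right, norm_smul, mul_pow, Real.norm_eq_abs, sq_abs,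
            abs_of_nonneg h]
        · refine ⟨false, ?_⟩
          simp only [signedStep]
          rw [sub_neg_eq_add, norm_add_sq_real, inner_smul_right, norm_smul, mul_pow,
            Real.norm_eq_abs, sq_abs, abs_of_nonpos h]
          ring
      -- Step size `τ / R²` along a point with inner product above `τ` lowers `R²‖v‖²` by at least
      -- `τ²`, so the budget `m τ²` pays for `m` steps.
      have hstep : R ^ 2 * ‖v - signedStep (τ / R ^ 2) z (some (k, b))‖ ^ 2 ≤ m * τ ^ 2 := by
        rw [hb]
        push_cast at hv
        have e1 : τ / R ^ 2 * τ ≤ τ / R ^ 2 * |inner ℝ v (z k)| := by gcongr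
        have e2 : (τ / R ^ 2) ^ 2 * ‖z k‖ ^ 2 ≤ (τ / R ^ 2) ^ 2 * R ^ 2 := by gcongr
        calc _ ≤ R ^ 2 * (‖v‖ ^ 2 - 2 * (τ / R ^ 2 * τ) + (τ / R ^ 2) ^ 2 * R ^ 2) := by gcongr
          _ = R ^ 2 * ‖v‖ ^ 2 - τ ^ 2 := by field_simp; ring
          _ ≤ m * τ ^ 2 := by linarith
      obtain ⟨M, hM⟩ := ih _ hstep
      refine ⟨some (k, b) ::ₛ M, fun l => ?_⟩
      have h1 : signedSum (τ / R ^ 2) z (some (k, b) ::ₛ M) =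
          signedStep (τ / R ^ 2) z (some (k, b)) + signedSum (τ / R ^ 2) z M := by
        rw [signedSum, Sym.coe_cons, Multiset.map_cons, Multiset.sum_cons, signedSum]
      rw [h1, ← sub_sub]
      exact hM l

/-- The set of indices in `A` at which `s` lies below its value at the index `t`
(all of `A` for `t = none`). -/
def thresholdSet (A : Set κ) (s : κ → ℝ) : Option κ → Set κ
  | none => A
  | some l => {k ∈ A | s k < s l}

/-- The smallest value of `s` that is at least `t` cuts off the same indices as `t`. Real thresholds
thus yield at most one set per index, plus one. -/
theorem exists_thresholdSet_eq [Finite κ] (A : Set κ) (s : κ → ℝ) (t : ℝ) :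
    ∃ o : Option κ, thresholdSet A s o = {k ∈ A | s k < t} := by
  by_cases h : ∃ k, t ≤ s k
  · obtain ⟨l, hl, hmin⟩ := Set.exists_min_image {k | t ≤ s k} s (Set.toFinite _) h
    refine ⟨some l, Set.ext fun k => and_congr_right fun _ => ?_⟩
    refine ⟨fun hk => ?_, fun hk => hk.trans_le hl⟩
    by_contra hcon
    exact (hmin k (not_lt.1 hcon)).not_gt hk
  · push Not at h
    exact ⟨none, Set.ext fun k => by simp [thresholdSet, h k]⟩

open Classical in
/-- Affine functionals with linear part of norm at most `V`, where `R² V² ≤ m τ²`, induce few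
patterns on finitely many points of norm at most `R`, up to a margin `2 τ`. -/
theorem exists_affine_patterns [Fintype κ] (A : Set κ) (z : κ → H) {R τ : ℝ} (hτ : 0 ≤ τ)
    (hz : ∀ k, ‖z k‖ ≤ R) (m : ℕ) :
    ∃ 𝒯 : Finset (Set κ),
      𝒯.card ≤ (2 * Fintype.card κ + m).choose m * (Fintype.card κ + 1) ∧
      ∀ (v : H) (t : ℝ), R ^ 2 * ‖v‖ ^ 2 ≤ m * τ ^ 2 → ∃ T ∈ 𝒯, ∀ k,
        (k ∈ A ∧ inner ℝ v (z k) < t - τ → k ∈ T) ∧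
        (k ∉ A ∨ t + τ ≤ inner ℝ v (z k) → k ∉ T) := by
  refine ⟨(Finset.univ : Finset (Sym (Option (κ × Bool)) m × Option κ)).image fun p =>
    thresholdSet A (fun k => inner ℝ (signedSum (τ / R ^ 2) z p.1) (z k)) p.2, ?_, ?_⟩
  · refine Finset.card_image_le.trans (le_of_eq ?_)
    rw [Finset.card_univ, Fintype.card_prod, Sym.card_sym_eq_choose]
    simp only [Fintype.card_option, Fintype.card_prod, Fintype.card_bool]
    congr 2
    omega
  · intro v t hv
    obtain ⟨M, hM⟩ := exists_signedSum_approx z hτ hz m v hv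
    obtain ⟨o, ho⟩ := exists_thresholdSet_eq A
      (fun k => inner ℝ (signedSum (τ / R ^ 2) z M) (z k)) t
    refine ⟨_, Finset.mem_image_of_mem _ (Finset.mem_univ (M, o)), fun k => ?_⟩
    have h := hM k
    rw [inner_sub_left, abs_le] at h
    simp only [ho, Set.mem_ofPred_eq]
    refine ⟨fun hk => ⟨hk.1, by linarith [hk.2, h.1]⟩, fun hk hk' => ?_⟩
    rcases hk with hk | hk
    · exact hk hk'.1
    · linarith [hk'.2, h.2]

end Cover

/-! ### Numerical estimates for the pattern count. -/

/-- `(4n + m choose m) ≤ exp (6 √(m n))` for `1 ≤ m ≤ n`. -/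
theorem choose_le_exp_sqrt {m n : ℕ} (hm : 1 ≤ m) (hmn : m ≤ n) :
    ((4 * n + m).choose m : ℝ) ≤ Real.exp (6 * √(m * n)) := by
  have hm0 : (0 : ℝ) < m := by exact_mod_cast hm
  have hn0 : (0 : ℝ) < n := by exact_mod_cast hm.trans hmn
  have hmn' : (m : ℝ) ≤ n := by exact_mod_cast hmn
  set q : ℝ := √(m / n) with hq
  have hq0 : 0 < q := by positivity
  have hq2 : q ^ 2 * n = m := by
    rw [hq, Real.sq_sqrt (by positivity)]; field_simp
  have hqn : q * n = √(m * n) := by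
    symm
    rw [Real.sqrt_eq_iff_mul_self_eq (by positivity) (by positivity)]
    nlinarith
  -- A single term of the binomial expansion of `(1 + q)^(4n + m)`; `q = √(m/n)` makes both `q n`
  -- and `m / q` equal to `√(mn)`.
  have h1 : ((4 * n + m).choose m : ℝ) * q ^ m ≤ (1 + q) ^ (4 * n + m) := by
    rw [add_comm 1 q, add_pow]
    refine le_trans (le_of_eq ?_) (Finset.single_le_sum (f := fun k =>
      q ^ k * 1 ^ (4 * n + m - k) * ((4 * n + m).choose k : ℝ)) (fun _ _ => by positivity)
      (Finset.mem_range.2 (show m < 4 * n + m + 1 by omega)))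
    simp [mul_comm]
  have h2 : (1 + q) ^ (4 * n + m) ≤ Real.exp (5 * √(m * n)) := by
    calc (1 + q) ^ (4 * n + m) ≤ Real.exp q ^ (4 * n + m) := by
          gcongr; linarith [Real.add_one_le_exp q]
      _ = Real.exp ((4 * n + m) * q) := by
          rw [← Real.exp_nat_mul]; push_cast; rfl
      _ ≤ Real.exp (5 * √(m * n)) := by
          rw [Real.exp_le_exp, ← hqn]
          nlinarith
  have h3 : Real.exp (-√(m * n)) ≤ q ^ m := by
    have : Real.exp (-(1 / q)) ≤ q := by
      rw [Real.exp_neg, inv_le_comm₀ (Real.exp_pos _) hq0]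
      have := Real.add_one_le_exp (1 / q)
      rw [← one_div]; linarith
    calc Real.exp (-√(m * n)) = Real.exp (-(1 / q)) ^ m := by
          rw [← Real.exp_nat_mul, ← hqn, ← hq2]
          congr 1
          field_simp
      _ ≤ q ^ m := by gcongr
  have h4 : ((4 * n + m).choose m : ℝ) * Real.exp (-√(m * n)) ≤ Real.exp (5 * √(m * n)) :=
    (mul_le_mul_of_nonneg_left h3 (by positivity)).trans (h1.trans h2)
  rw [Real.exp_neg, ← div_eq_mul_inv, div_le_iff₀ (Real.exp_pos _), ← Real.exp_add] at h4
  rwa [show 6 * √(m * n : ℝ) = 5 * √(m * n) + √(m * n) by ring]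

/-- The error level `(22 + 4K) (√(m/n) + √(log (1/δ) / n))` of complexity class `m`. -/
noncomputable def errorLevel (K n m : ℕ) (δ : ℝ) : ℝ :=
  (22 + 4 * K) * (√(m / n) + √(Real.log (1 / δ) / n))

theorem exp_half_le_one_add {x : ℝ} (h0 : 0 ≤ x) (h1 : x ≤ 1) : Real.exp (x / 2) ≤ 1 + x := by
  have h := Real.add_one_le_exp (-(x / 2))
  have h2 : Real.exp (x / 2) * Real.exp (-(x / 2)) = 1 := by rw [← Real.exp_add]; simp
  have h3 := Real.exp_pos (x / 2)
  nlinarith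

/-- With `s = √(mn)` and `r = √(n log(1/δ))`, the exponents are `6s` for multisets, `4s` for
thresholds, `Ks` and `s` for the union-bound weights `K` and `2^m`, and `r` for `δ⁻¹`. Their sum is
at most `(11 + 2K)(s + r)`; the constant `22 + 4K` doubles this because `exp(x/2) ≤ 1 + x` loses a
factor 2. -/
theorem patterns_le_one_add_errorLevel_pow {K n m : ℕ} (hn : 1 ≤ n) (hm : 1 ≤ m) {δ : ℝ}
    (hδ0 : 0 < δ) (hδ1 : δ ≤ 1) (hε : errorLevel K n m δ ≤ 1) :
    (((4 * n + m).choose m * (2 * n + 1) : ℕ) : ℝ) * (K * 2 ^ m) * δ⁻¹ ≤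
      (1 + errorLevel K n m δ) ^ n := by
  have hn0 : (1 : ℝ) ≤ n := by exact_mod_cast hn
  have hm0 : (1 : ℝ) ≤ m := by exact_mod_cast hm
  have hK : (0 : ℝ) ≤ K := by positivity
  set l := Real.log (1 / δ) with hl
  have hl0 : 0 ≤ l := Real.log_nonneg (by rw [le_div_iff₀ hδ0]; linarith)
  have hexpl : Real.exp l = δ⁻¹ := by rw [hl, Real.exp_log (by positivity), one_div]
  have hconv : ∀ t : ℝ, 0 ≤ t → √(t / n) * n = √(t * n) := fun t ht => by
    rw [Real.sqrt_div' _ (by positivity), Real.sqrt_mul ht, div_mul_eq_mul_div, div_eq_iff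
      (by positivity), mul_assoc, Real.mul_self_sqrt (by positivity)]
  set s := √(m * n : ℝ) with hs
  set r := √(l * n) with hr
  have hA : (22 + 4 * K : ℝ) * (√(m / n) + √(l / n)) ≤ 1 := hε
  have hp1 := Real.sqrt_nonneg (m / n : ℝ)
  have hp2 := Real.sqrt_nonneg (l / n : ℝ)
  have hsum : √(m / n : ℝ) + √(l / n) ≤ 1 := by nlinarith
  have hle : ∀ t : ℝ, 0 ≤ t → √(t / n) ≤ 1 → t ≤ n ∧ t ≤ √(t * n) := fun t ht h => by
    rw [Real.sqrt_le_one, div_le_one (by positivity)] at h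
    exact ⟨h, Real.le_sqrt_of_sq_le (by nlinarith)⟩
  obtain ⟨hmn, hms⟩ := hle m (by positivity) (by linarith)
  obtain ⟨-, hlr⟩ := hle l hl0 (by linarith)
  have hs1 : 1 ≤ s := hm0.trans hms
  have hr0 : 0 ≤ r := Real.sqrt_nonneg _
  have e1 : ((4 * n + m).choose m : ℝ) ≤ Real.exp (6 * s) :=
    choose_le_exp_sqrt hm (by exact_mod_cast hmn)
  have e2 : (2 * n + 1 : ℝ) ≤ Real.exp (4 * s) := by
    have hns : (n : ℝ) ≤ s ^ 2 := by rw [hs, Real.sq_sqrt (by positivity)]; nlinarith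
    have := Real.quadratic_le_exp_of_nonneg (x := 4 * s) (by positivity)
    nlinarith
  have e3 : (K : ℝ) ≤ Real.exp (K * s) := by
    have := Real.add_one_le_exp (K * s)
    nlinarith
  have e4 : (2 : ℝ) ^ m ≤ Real.exp s := by
    calc (2 : ℝ) ^ m ≤ Real.exp 1 ^ m := by gcongr; linarith [Real.add_one_le_exp 1]
      _ = Real.exp m := by rw [← Real.exp_nat_mul, mul_one]
      _ ≤ Real.exp s := Real.exp_le_exp.2 hms
  have e5 : δ⁻¹ ≤ Real.exp r := hexpl ▸ Real.exp_le_exp.2 hlr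
  have hε0 : 0 ≤ errorLevel K n m δ := by unfold errorLevel; positivity
  calc _ ≤ Real.exp (6 * s) * Real.exp (4 * s) * (Real.exp (K * s) * Real.exp s) * Real.exp r := by
        push_cast
        gcongr
    _ = Real.exp (6 * s + 4 * s + (K * s + s) + r) := by simp only [Real.exp_add]
    _ ≤ Real.exp (n * (errorLevel K n m δ / 2)) := by
        rw [Real.exp_le_exp]
        have : n * (errorLevel K n m δ / 2) = (11 + 2 * K) * (s + r) := by
          rw [hs, hr, ← hconv m (by positivity), ← hconv l hl0, errorLevel]
          ring
        rw [this]
        nlinarith [mul_nonneg hK (zero_le_one.trans hs1), mul_nonneg hK hr0]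
    _ = Real.exp (errorLevel K n m δ / 2) ^ n := Real.exp_nat_mul _ _
    _ ≤ _ := by gcongr; exact exp_half_le_one_add hε0 hε

/-! ### Uniform margin bounds for affine functionals. -/

section Affine

variable {Z H : Type*} [MeasurableSpace Z] [NormedAddCommGroup H] [InnerProductSpace ℝ H]
  [MeasurableSpace H] [BorelSpace H]

/-- Uniform bound for a countable family of affine functionals of complexity class `m`. -/
theorem pi_exists_affine_consistent_le (P : Measure Z) [IsProbabilityMeasure P] {F : Z → H}
    (hF : Measurable F) {R : ℝ} (hR : ∀ z, ‖F z‖ ≤ R) {A : Set Z} (hA : MeasurableSet A)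
    {D : Set (H × ℝ)} (hD : D.Countable) {K n m : ℕ} (hK : 1 ≤ K) (hn : 1 ≤ n) (hm : 1 ≤ m)
    {δ : ℝ} (hδ0 : 0 < δ) (hδ1 : δ ≤ 1) :
    Measure.pi (fun _ : Fin n => P) {S | ∃ p ∈ D, 16 * (R * ‖p.1‖) ^ 2 ≤ m ∧
      ENNReal.ofReal (errorLevel K n m δ) < P (A ∩ {z | inner ℝ p.1 (F z) + p.2 ≤ 1 / 8}) ∧
      ∀ k, S k ∈ A → 7 / 8 ≤ inner ℝ p.1 (F (S k)) + p.2} ≤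
    ENNReal.ofReal (δ / (K * 2 ^ m)) := by
  classical
  set ε := errorLevel K n m δ with hε
  have hε0 : 0 ≤ ε := by rw [hε]; unfold errorLevel; positivity
  -- For `ε > 1` the event is empty, since no probability exceeds 1.
  rcases lt_or_ge 1 ε with h1 | h1
  · refine le_of_eq_of_le (measure_mono_null (t := ∅) ?_ measure_empty) zero_le
    rintro S ⟨p, -, -, hp, -⟩
    have h2 : (1 : ℝ≥0∞) ≤ ENNReal.ofReal ε := by simpa using ENNReal.ofReal_le_ofReal h1.le
    exact (hp.trans_le prob_le_one).not_ge h2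
  · have : Countable D := hD
    have hfm : ∀ p : H × ℝ, Measurable fun z => inner ℝ p.1 (F z) + p.2 := fun p =>
      (((continuous_const.inner continuous_id).measurable.comp hF).add_const _)
    let ι := {p : D // 16 * (R * ‖p.1.1‖) ^ 2 ≤ m}
    have key := pi_exists_consistent_mul_le P (ι := ι) (n := n)
      (fun p => A ∩ {z | inner ℝ p.1.1.1 (F z) + p.1.1.2 ≤ 1 / 8})
      (fun p => Aᶜ ∪ {z | 7 / 8 ≤ inner ℝ p.1.1.1 (F z) + p.1.1.2})
      (fun p => hA.inter (measurableSet_le (hfm _) measurable_const))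
      (fun p => hA.compl.union (measurableSet_le measurable_const (hfm _)))
      ((4 * n + m).choose m * (2 * n + 1)) (fun z => ?_) (ENNReal.ofReal ε)
    · have hsub : {S : Fin n → Z | ∃ p ∈ D, 16 * (R * ‖p.1‖) ^ 2 ≤ m ∧
          ENNReal.ofReal ε < P (A ∩ {z | inner ℝ p.1 (F z) + p.2 ≤ 1 / 8}) ∧
          ∀ k, S k ∈ A → 7 / 8 ≤ inner ℝ p.1 (F (S k)) + p.2} ⊆
          {S | ∃ p : ι, ENNReal.ofReal ε ≤
            P (A ∩ {z | inner ℝ p.1.1.1 (F z) + p.1.1.2 ≤ 1 / 8}) ∧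
            ∀ k, S k ∈ Aᶜ ∪ {z | 7 / 8 ≤ inner ℝ p.1.1.1 (F z) + p.1.1.2}} := by
        rintro S ⟨p, hp, hpm, hpε, hpS⟩
        exact ⟨⟨⟨p, hp⟩, hpm⟩, hpε.le, fun k => or_iff_not_imp_left.2 fun h => hpS k (not_not.1 h)⟩
      refine (measure_mono hsub).trans ?_
      set q := Measure.pi (fun _ : Fin n => P) {S | ∃ p : ι, ENNReal.ofReal ε ≤
            P (A ∩ {z | inner ℝ p.1.1.1 (F z) + p.1.1.2 ≤ 1 / 8}) ∧
            ∀ k, S k ∈ Aᶜ ∪ {z | 7 / 8 ≤ inner ℝ p.1.1.1 (F z) + p.1.1.2}}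
      have hpow : (1 + ENNReal.ofReal ε) ^ n = ENNReal.ofReal ((1 + ε) ^ n) := by
        rw [ENNReal.ofReal_pow (by positivity), ENNReal.ofReal_add zero_le_one hε0,
          ENNReal.ofReal_one]
      rw [hpow, mul_comm, ← ENNReal.le_div_iff_mul_le (by left; positivity) (by simp),
        ← ENNReal.ofReal_natCast, ← ENNReal.ofReal_div_of_pos (by positivity)] at key
      refine key.trans (ENNReal.ofReal_le_ofReal ?_)
      have hK0 : (0 : ℝ) < K := by exact_mod_cast hK
      have h2 := patterns_le_one_add_errorLevel_pow (K := K) hn hm hδ0 hδ1 h1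
      rw [← hε] at h2
      rw [div_le_div_iff₀ (by positivity) (by positivity)]
      rwa [← div_eq_mul_inv, div_le_iff₀ hδ0, mul_comm ((1 + ε) ^ n)] at h2
    · obtain ⟨𝒯, hcard, h𝒯⟩ := exists_affine_patterns {k | z k ∈ A} (fun k => F (z k))
        (τ := 1 / 4) (by norm_num) (fun k => hR (z k)) m
      refine ⟨𝒯, hcard.trans (le_of_eq ?_), fun p => ?_⟩
      · simp only [Fintype.card_prod, Fintype.card_fin, Fintype.card_bool]
        congr 2 <;> ring
      -- Cutting at height `1/2` with accuracy `1/4` separates values at most `1/8` from values at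
      -- least `7/8`.
      · obtain ⟨T, hT, h⟩ := h𝒯 p.1.1.1 (1 / 2 - p.1.1.2) (by nlinarith [p.2])
        refine ⟨T, hT, fun k => ⟨fun hk => (h k).1 ⟨hk.1, ?_⟩, fun hk => (h k).2 (hk.imp id ?_)⟩⟩
        · have := hk.2
          rw [Set.mem_ofPred_eq] at this
          linarith
        · intro hk
          rw [Set.mem_ofPred_eq] at hk
          linarith

/-- Margin bound, uniform over all classes `A y`, all complexity classes and all affine
functionals that are at least `1` on the sample points of the class. -/
theorem exists_affine_margin_bound [TopologicalSpace.SeparableSpace H]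
    (P : Measure Z) [IsProbabilityMeasure P] {F : Z → H}
    (hF : Measurable F) {R : ℝ} (hR : ∀ z, ‖F z‖ ≤ R) {K n : ℕ} (hK : 1 ≤ K) (hn : 1 ≤ n)
    {A : Fin K → Set Z} (hA : ∀ y, MeasurableSet (A y)) {δ : ℝ} (hδ0 : 0 < δ) (hδ1 : δ ≤ 1) :
    ∃ B : Set (Fin n → Z), Measure.pi (fun _ => P) B ≤ ENNReal.ofReal δ ∧
      ∀ S ∉ B, ∀ y, ∀ m : ℕ, 1 ≤ m → ∀ (v : H) (β : ℝ), 16 * (R * ‖v‖ + 1 / 8) ^ 2 ≤ m →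
        (∀ k, S k ∈ A y → 1 ≤ inner ℝ v (F (S k)) + β) →
        P (A y ∩ {z | inner ℝ v (F z) + β ≤ 0}) ≤ ENNReal.ofReal (errorLevel K n m δ) := by
  -- A countable dense set of functionals keeps the supremum in the symmetrization measurable;
  -- levels 0 and 1 relax to `1/8` and `7/8` in exchange.
  obtain ⟨D, hDc, hDd⟩ := TopologicalSpace.exists_countable_dense (H × ℝ)
  let Bad : Fin K → ℕ → Set (Fin n → Z) := fun y m =>
    {S | ∃ p ∈ D, 16 * (R * ‖p.1‖) ^ 2 ≤ m ∧
      ENNReal.ofReal (errorLevel K n m δ) < P (A y ∩ {z | inner ℝ p.1 (F z) + p.2 ≤ 1 / 8}) ∧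
      ∀ k, S k ∈ A y → 7 / 8 ≤ inner ℝ p.1 (F (S k)) + p.2}
  have hK0 : (0 : ℝ) < K := by exact_mod_cast hK
  refine ⟨⋃ y, ⋃ m, Bad y (m + 1), ?_, ?_⟩
  · calc _ ≤ ∑ y, ∑' m, Measure.pi (fun _ => P) (Bad y (m + 1)) :=
          (measure_iUnion_fintype_le _ _).trans
            (Finset.sum_le_sum fun y _ => measure_iUnion_le _)
      _ ≤ ∑ _y : Fin K, ∑' m : ℕ, ENNReal.ofReal (δ / K / 2 / 2 ^ m) := by
          refine Finset.sum_le_sum fun y _ => ENNReal.tsum_le_tsum fun m => ?_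
          refine (pi_exists_affine_consistent_le P hF hR (hA y) hDc hK hn (Nat.le_add_left 1 m)
            hδ0 hδ1).trans (le_of_eq ?_)
          congr 1
          field_simp
          ring
      _ = ∑ _y : Fin K, ENNReal.ofReal (δ / K) := by
          rw [← ENNReal.ofReal_tsum_of_nonneg (fun m => by positivity)
            (summable_geometric_two' _), tsum_geometric_two']
      _ = ENNReal.ofReal δ := by
          rw [Finset.sum_const, Finset.card_univ, Fintype.card_fin, nsmul_eq_mul,
            ← ENNReal.ofReal_natCast, ← ENNReal.ofReal_mul hK0.le, mul_div_cancel₀ _ hK0.ne']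
  · intro S hS y m hm v β hv hmargin
    by_contra! hcon
    have hne : Nonempty Z := by
      by_contra h
      rw [not_nonempty_iff] at h
      rw [Set.eq_empty_of_isEmpty (A y ∩ _), measure_empty] at hcon
      exact not_lt_zero hcon
    have hR0 : 0 ≤ R := (norm_nonneg _).trans (hR hne.some)
    -- This radius moves the linear part on the ball and the offset by at most `1/16` each.
    obtain ⟨p, hpD, hp⟩ := Metric.dense_iff.1 hDd (v, β) (1 / (16 * (R + 1))) (by positivity)
    rw [Metric.mem_ball, Prod.dist_eq, max_lt_iff, dist_eq_norm, Real.dist_eq, Prod.fst,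
      Prod.snd] at hpD
    obtain ⟨hpv, hpβ⟩ := hpD
    have hρ : 1 / (16 * (R + 1)) * (R + 1) = 1 / 16 := by field_simp
    have hρ1 : 1 / (16 * (R + 1)) ≤ 1 / 16 := by
      rw [div_le_div_iff₀ (by positivity) (by norm_num)]; linarith
    have hRv : R * ‖p.1 - v‖ ≤ 1 / 16 := by
      nlinarith [norm_nonneg (p.1 - v)]
    have hclose : ∀ z, |inner ℝ p.1 (F z) + p.2 - (inner ℝ v (F z) + β)| ≤ 1 / 8 := fun z => by
      have h1 : |inner ℝ (p.1 - v) (F z)| ≤ 1 / 16 :=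
        (abs_real_inner_le_norm _ _).trans (by nlinarith [norm_nonneg (p.1 - v), hR z])
      rw [inner_sub_left] at h1
      rw [abs_le] at h1 ⊢
      rw [abs_lt] at hpβ
      constructor <;> linarith [h1.1, h1.2, hpβ.1, hpβ.2]
    obtain ⟨m, rfl⟩ := Nat.exists_eq_add_of_le' hm
    refine hS (Set.mem_iUnion.2 ⟨y, Set.mem_iUnion.2 ⟨m, p, hp, ?_, ?_, ?_⟩⟩)
    · have h1 : ‖p.1‖ ≤ ‖v‖ + ‖p.1 - v‖ := by
        simpa using norm_add_le v (p.1 - v)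
      have h2 : R * ‖p.1‖ ≤ R * ‖v‖ + 1 / 8 := by nlinarith
      refine le_trans ?_ hv
      gcongr
    · refine hcon.trans_le (measure_mono (Set.inter_subset_inter_right _ fun z hz => ?_))
      rw [Set.mem_ofPred_eq] at hz ⊢
      linarith [(abs_le.1 (hclose z)).2]
    · intro k hk
      linarith [(abs_le.1 (hclose (S k))).1, hmargin k hk]

end Affine

/-! ### From prototypes to affine functionals. -/

/-- For a strictly decreasing link, the classifier is the nearest-prototype classifier. -/
theorem IsClassifier.dist_le {E : Type*} {K : ℕ} {d : E → E → ℝ≥0} {κ : ℝ≥0 → ℝ≥0∞}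
    (hκ : StrictAnti κ) {W : Fin K → E} {h : E → Fin K} (hh : IsClassifier d κ W h) (x : E)
    (j : Fin K) : d x (W (h x)) ≤ d x (W j) := by
  classical
  by_contra! hlt
  have hs : score d κ W x (h x) < score d κ W x j := hκ hlt
  have htop : score d κ W x (h x) ≠ ⊤ := hs.ne_top
  have hle := hh x
  -- If some weight is infinite, the finite weight of `h x` gets probability 0 while an infinite one
  -- gets a positive share. Otherwise all weights have a common finite, nonzero denominator.
  by_cases hex : ∃ l, score d κ W x l = ⊤
  · obtain ⟨l, hl⟩ := hex
    have h1 := hle l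
    have hsum : ∑ i, score d κ W x i = ⊤ :=
      ENNReal.sum_eq_top.2 ⟨l, Finset.mem_univ l, hl⟩
    rw [classProb, if_pos hl, classProb, if_neg htop, hsum, ENNReal.div_top, le_zero_iff,
      ENNReal.inv_eq_zero] at h1
    exact ENNReal.natCast_ne_top _ h1
  · push Not at hex
    have h1 := hle j
    rw [classProb, if_neg (hex j), classProb, if_neg htop] at h1
    refine h1.not_gt (ENNReal.div_lt_div_right ?_ ?_ hs)
    · intro h0
      rw [Finset.sum_eq_zero_iff] at h0
      rw [h0 j (Finset.mem_univ j)] at hs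
      exact not_lt_zero hs
    · exact ENNReal.sum_ne_top.2 fun i _ => hex i

theorem margin_le {E : Type*} {K n : ℕ} (d : E → E → ℝ≥0) (S : Sample E K n) (W : Fin K → E)
    (i : Fin n) {j : Fin K} (hj : j ≠ (S i).2) :
    margin d S W ≤ d (S i).1 (W j) - d (S i).1 (W (S i).2) := by
  refine (ciInf_le (Set.finite_range _).bddBelow i).trans (sub_le_sub_right ?_ _)
  exact ciInf_le (f := fun j : {j : Fin K // j ≠ (S i).2} => (d (S i).1 (W j) : ℝ))
    (Set.finite_range _).bddBelow ⟨j, hj⟩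

theorem norm_le_capacity {E H : Type*} [NormedAddCommGroup H] {K : ℕ} (ψ : E → H)
    (W : Fin K → E) (k : Fin K) : ‖ψ (W k)‖ ≤ capacity ψ W :=
  Real.le_sqrt_of_sq_le
    (Finset.single_le_sum (f := fun k => ‖ψ (W k)‖ ^ 2) (fun _ _ => by positivity)
      (Finset.mem_univ k))

theorem strictAnti_harmonicLink {ω : ℝ} (hω : 0 < ω) : StrictAnti (harmonicLink ω) := by
  intro r s hrs
  unfold harmonicLink
  rw [ENNReal.rpow_neg, ENNReal.rpow_neg, ENNReal.inv_lt_inv]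
  exact ENNReal.rpow_lt_rpow (by exact_mod_cast hrs) hω

theorem marginBound_eq_ofReal {C R N γ δ : ℝ} {n : ℕ} (hC : 0 ≤ C) (hR : 0 ≤ R) (hN : 0 ≤ N)
    (hγ : 0 < γ) (hn : 1 ≤ n) : marginBound C R N γ n δ =
      ENNReal.ofReal (C * (R * N / (γ * √n) + √(Real.log (1 / δ) / n))) := by
  have hn0 : (0 : ℝ) < n := by exact_mod_cast hn
  rw [marginBound, ENNReal.ofReal_mul hC, ENNReal.ofReal_add (by positivity) (by positivity),
    ENNReal.ofReal_div_of_pos (by positivity)]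

/-- The error level of complexity class `⌈512 x²⌉ + 1` in terms of `x`. -/
theorem errorLevel_le {K n : ℕ} (hn : 1 ≤ n) {δ : ℝ} (hδ0 : 0 < δ) (hδ : δ ≤ 1 / 2) {x : ℝ}
    (hx : 0 ≤ x) : errorLevel K n (⌈512 * x ^ 2⌉₊ + 1) δ ≤
      23 * (22 + 4 * K) * (x / √n + √(Real.log (1 / δ) / n)) := by
  have hn0 : (0 : ℝ) < n := by exact_mod_cast hn
  -- Here `δ ≤ 1/2` enters: the confidence term absorbs the additive constant from rounding `m`. The
  -- factor 23 comes from `512 ≤ 23²`.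
  have hl : 1 / 4 ≤ Real.log (1 / δ) := by
    have h2 : Real.log 2 ≤ Real.log (1 / δ) := by
      refine Real.log_le_log (by norm_num) ?_
      rw [le_div_iff₀ hδ0]; linarith
    linarith [Real.log_two_gt_d9]
  set l := Real.log (1 / δ)
  have h1 : 1 ≤ 2 * √l := by
    have : 1 / 2 ≤ √l := Real.le_sqrt_of_sq_le (by linarith)
    linarith
  have h2 : √((⌈512 * x ^ 2⌉₊ + 1 : ℕ) : ℝ) ≤ 23 * x + 2 * (2 * √l) := by
    have hceil := (Nat.ceil_lt_add_one (show 0 ≤ 512 * x ^ 2 by positivity)).le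
    have : √((⌈512 * x ^ 2⌉₊ + 1 : ℕ) : ℝ) ≤ 23 * x + 2 := by
      refine Real.sqrt_le_iff.2 ⟨by positivity, ?_⟩
      push_cast
      nlinarith
    linarith
  rw [errorLevel, Real.sqrt_div' _ hn0.le, Real.sqrt_div' _ hn0.le, ← add_div, ← add_div,
    mul_div_assoc', mul_div_assoc']
  gcongr ?_ / _
  have h3 : √((⌈512 * x ^ 2⌉₊ + 1 : ℕ) : ℝ) + √l ≤ 23 * (x + √l) := by
    linarith [Real.sqrt_nonneg l]
  calc _ ≤ (22 + 4 * K) * (23 * (x + √l)) := by gcongr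
    _ = _ := by ring

/-- Margin bound for all nearest-prototype classifiers. -/
theorem exists_nearestPrototype_margin_bound {E H : Type*} [MeasurableSpace E]
    [NormedAddCommGroup H] [InnerProductSpace ℝ H] [TopologicalSpace.SeparableSpace H]
    [MeasurableSpace H] [BorelSpace H] {K n : ℕ} (hK : 1 ≤ K) (hn : 1 ≤ n)
    {d : E → E → ℝ≥0} {X Θ : Set E} {φ ψ : E → H} (hφ : Measurable φ)
    (hd : IsInducedBy d X Θ φ ψ) (P : Measure (E × Fin K)) [IsProbabilityMeasure P] {c : H}
    {R : ℝ} (hP : ∀ᵐ z ∂P, z.1 ∈ X ∧ ‖φ z.1 - c‖ ≤ R) {δ : ℝ} (hδ0 : 0 < δ) (hδ : δ ≤ 1 / 2) :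
    ∃ G : Set (Sample E K n), MeasurableSet G ∧
      1 - ENNReal.ofReal δ ≤ Measure.pi (fun _ : Fin n => P) G ∧
      ∀ S ∈ G, ∀ W : Fin K → E, (∀ k, W k ∈ Θ) → 0 < margin d S W → ∀ h : E → Fin K,
        (∀ x j, d x (W (h x)) ≤ d x (W j)) →
        errorProb P h ≤
          marginBound (K ^ 2 * (23 * (22 + 4 * K))) R (capacity ψ W) (margin d S W) n δ := by
  classical
  obtain ⟨a, b, hab⟩ := hd
  have hR0 : 0 ≤ R := by
    obtain ⟨z, -, hz⟩ := hP.exists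
    exact (norm_nonneg _).trans hz
  set μ := Measure.pi (fun _ : Fin n => P) with hμ
  -- Truncation makes the norm bound hold everywhere; it changes `φ - c` only on a null set.
  let F : E × Fin K → H := fun z => if ‖φ z.1 - c‖ ≤ R then φ z.1 - c else 0
  have hφc : Measurable fun z : E × Fin K => φ z.1 - c :=
    (continuous_id.sub continuous_const).measurable.comp (hφ.comp measurable_fst)
  have hF : Measurable F :=
    Measurable.ite (measurableSet_le (continuous_norm.measurable.comp hφc) measurable_const) hφc
      measurable_const
  have hFR : ∀ z, ‖F z‖ ≤ R := fun z => by
    by_cases hz : ‖φ z.1 - c‖ ≤ R <;> simp [F, hz, hR0]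
  obtain ⟨B, hBδ, hB⟩ := exists_affine_margin_bound P hF hFR hK hn
    (A := fun y => {z | z.2 = y}) (fun y => measurable_snd (measurableSet_singleton y)) hδ0
    (by linarith)
  let N : Set (E × Fin K) := {z | ¬(z.1 ∈ X ∧ ‖φ z.1 - c‖ ≤ R)}
  have hN : P N = 0 := hP
  have hNS : μ (⋃ k, {S : Fin n → E × Fin K | S k ∈ N}) = 0 := measure_iUnion_null fun k =>
    (Measure.quasiMeasurePreserving_eval (fun _ : Fin n => P) k).preimage_null hN
  -- The bad event need not be measurable, so its measurable hull is removed.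
  set B' := toMeasurable μ (B ∪ ⋃ k, {S : Fin n → E × Fin K | S k ∈ N}) with hB'
  refine ⟨B'ᶜ, (measurableSet_toMeasurable _ _).compl, ?_, fun S hS W hW hγ h hh => ?_⟩
  · rw [prob_compl_eq_one_sub (measurableSet_toMeasurable _ _), measure_toMeasurable]
    refine tsub_le_tsub_left ((measure_union_le _ _).trans ?_) 1
    rw [hNS, add_zero]
    exact hBδ
  · have hS' : S ∉ B ∪ ⋃ k, {S : Fin n → E × Fin K | S k ∈ N} := fun hmem =>
      hS (subset_toMeasurable _ _ hmem)
    rw [Set.mem_union, not_or] at hS'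
    have hSg : ∀ k, (S k).1 ∈ X ∧ ‖φ (S k).1 - c‖ ≤ R := fun k => by
      by_contra hcon
      exact hS'.2 (Set.mem_iUnion.2 ⟨k, hcon⟩)
    set γ := margin d S W
    have hcap : 0 ≤ capacity ψ W := Real.sqrt_nonneg _
    set x := R * capacity ψ W / γ with hx
    have hx0 : 0 ≤ x := by positivity
    let v : Fin K → Fin K → H := fun y j => (2 / γ) • (ψ (W y) - ψ (W j))
    let β : Fin K → Fin K → ℝ := fun y j =>
      (b (W j) - b (W y) - 2 * inner ℝ c (ψ (W j) - ψ (W y))) / γ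
    have hdiff : ∀ y j, ∀ z : E × Fin K, z.1 ∈ X ∧ ‖φ z.1 - c‖ ≤ R →
        inner ℝ (v y j) (F z) + β y j = ((d z.1 (W j) : ℝ) - d z.1 (W y)) / γ := by
      intro y j z hz
      have hFz : F z = φ z.1 - c := if_pos hz.2
      rw [hFz, hab _ hz.1 _ (hW j), hab _ hz.1 _ (hW y)]
      simp only [v, β, real_inner_smul_left, inner_sub_left, inner_sub_right]
      rw [real_inner_comm (φ z.1) (ψ (W y)), real_inner_comm (φ z.1) (ψ (W j)),
        real_inner_comm c (ψ (W y)), real_inner_comm c (ψ (W j))]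
      field_simp
      ring
    have hvR : ∀ y j, R * ‖v y j‖ ≤ 4 * x := fun y j => by
      have h1 : ‖ψ (W y) - ψ (W j)‖ ≤ 2 * capacity ψ W := by
        linarith [norm_sub_le (ψ (W y)) (ψ (W j)), norm_le_capacity ψ W y,
          norm_le_capacity ψ W j]
      calc R * ‖v y j‖ = R * (2 / γ * ‖ψ (W y) - ψ (W j)‖) := by
            rw [norm_smul, Real.norm_of_nonneg (by positivity)]
        _ ≤ R * (2 / γ * (2 * capacity ψ W)) := by gcongr
        _ = 4 * x := by rw [hx]; ring
    -- Chosen so that `16 (4x + 1/8)² ≤ 512 x² + 1/2 ≤ m`.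
    set m := ⌈512 * x ^ 2⌉₊ + 1 with hm
    have hpair : ∀ y j, j ≠ y → P ({z | z.2 = y} ∩ {z | inner ℝ (v y j) (F z) + β y j ≤ 0}) ≤
        ENNReal.ofReal (errorLevel K n m δ) := by
      intro y j hj
      refine hB S hS'.1 y m (Nat.le_add_left 1 _) (v y j) (β y j) ?_ fun k hk => ?_
      · have h1 : 16 * (R * ‖v y j‖ + 1 / 8) ^ 2 ≤ 16 * (4 * x + 1 / 8) ^ 2 := by
          gcongr ?_ * (?_ + _) ^ 2; exact hvR y j
        have h2 := Nat.le_ceil (512 * x ^ 2)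
        rw [hm]
        push_cast
        nlinarith [sq_nonneg (4 * x - 1 / 8)]
      · rw [Set.mem_ofPred_eq] at hk
        rw [hdiff y j _ (hSg k), le_div_iff₀ hγ, one_mul]
        subst hk
        exact margin_le d S W k hj
    -- The covering sets do not depend on `h`, so an arbitrary, possibly nonmeasurable tie-breaking
    -- is covered.
    have hsub : {z : E × Fin K | h z.1 ≠ z.2} ⊆ N ∪ ⋃ p : {p : Fin K × Fin K // p.2 ≠ p.1},
        ({z | z.2 = p.1.1} ∩ {z | inner ℝ (v p.1.1 p.1.2) (F z) + β p.1.1 p.1.2 ≤ 0}) := by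
      intro z hz
      by_cases hzN : z ∈ N
      · exact Or.inl hzN
      · refine Or.inr (Set.mem_iUnion.2 ⟨⟨(z.2, h z.1), hz⟩, rfl, ?_⟩)
        rw [Set.mem_ofPred_eq, hdiff _ _ _ (not_not.1 hzN)]
        refine div_nonpos_of_nonpos_of_nonneg ?_ hγ.le
        rw [sub_nonpos]
        exact_mod_cast hh z.1 z.2
    have hlevel : 0 ≤ errorLevel K n m δ := by unfold errorLevel; positivity
    rw [marginBound_eq_ofReal (by positivity) hR0 hcap hγ hn]
    calc errorProb P h ≤ P N + ∑ p : {p : Fin K × Fin K // p.2 ≠ p.1},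
          P ({z | z.2 = p.1.1} ∩ {z | inner ℝ (v p.1.1 p.1.2) (F z) + β p.1.1 p.1.2 ≤ 0}) :=
          (measure_mono hsub).trans ((measure_union_le _ _).trans
            (add_le_add_right (measure_iUnion_fintype_le _ _) _))
      _ ≤ 0 + ∑ _p : {p : Fin K × Fin K // p.2 ≠ p.1}, ENNReal.ofReal (errorLevel K n m δ) :=
          add_le_add hN.le (Finset.sum_le_sum fun p _ => hpair _ _ p.2)
      _ ≤ (K ^ 2 : ℕ) * ENNReal.ofReal (errorLevel K n m δ) := by
          rw [zero_add, Finset.sum_const, nsmul_eq_mul, Finset.card_univ]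
          gcongr
          refine (Fintype.card_subtype_le _).trans (le_of_eq ?_)
          simp [sq]
      _ = ENNReal.ofReal (K ^ 2 * errorLevel K n m δ) := by
          rw [ENNReal.ofReal_mul (by positivity), ← ENNReal.ofReal_natCast]
          push_cast
          rfl
      _ ≤ _ := by
          refine ENNReal.ofReal_le_ofReal ?_
          rw [mul_assoc]
          have h1 := errorLevel_le (K := K) hn hδ0 hδ hx0
          rw [hx, div_div, ← hx] at h1
          gcongr

end PrototypeLayer

theorem mainTheorem2 (K : ℕ) (hK : 2 ≤ K) :
    ∃ C : ℝ, 0 < C ∧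
      ∀ (D : ℕ) (d : EuclideanSpace ℝ (Fin D) → EuclideanSpace ℝ (Fin D) → ℝ≥0)
        (X Θ : Set (EuclideanSpace ℝ (Fin D)))
        (H : Type*) [NormedAddCommGroup H] [InnerProductSpace ℝ H] [CompleteSpace H]
        [TopologicalSpace.SeparableSpace H] [MeasurableSpace H] [BorelSpace H]
        (φ ψ : EuclideanSpace ℝ (Fin D) → H),
        Measurable φ → IsInducedBy d X Θ φ ψ →
      ∀ (P : Measure (EuclideanSpace ℝ (Fin D) × Fin K)) [IsProbabilityMeasure P]
        (c : H) (R : ℝ), (∀ᵐ z ∂P, z.1 ∈ X ∧ ‖φ z.1 - c‖ ≤ R) →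
      ∀ (n : ℕ), 1 ≤ n → ∀ (δ : ℝ), 0 < δ → δ ≤ 1 / 2 →
        (∀ κ : ℝ≥0 → ℝ≥0∞, StrictAnti κ →
          ∃ G : Set (Sample (EuclideanSpace ℝ (Fin D)) K n), MeasurableSet G ∧
            1 - ENNReal.ofReal δ ≤ Measure.pi (fun _ : Fin n => P) G ∧
            ∀ S ∈ G, ∀ W : Fin K → EuclideanSpace ℝ (Fin D), (∀ k, W k ∈ Θ) →
              0 < margin d S W → ∀ h, IsClassifier d κ W h →
                errorProb P h ≤ marginBound C R (capacity ψ W) (margin d S W) n δ) ∧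
        (∀ ω : ℝ, 0 < ω →
          ∃ G : Set (Sample (EuclideanSpace ℝ (Fin D)) K n), MeasurableSet G ∧
            1 - ENNReal.ofReal δ ≤ Measure.pi (fun _ : Fin n => P) G ∧
            ∀ S ∈ G, ∀ W : Fin K → EuclideanSpace ℝ (Fin D), (∀ k, W k ∈ Θ) →
              (∀ W' : Fin K → EuclideanSpace ℝ (Fin D), (∀ k, W' k ∈ Θ) →
                empiricalLoss d (harmonicLink ω) S W ≤ empiricalLoss d (harmonicLink ω) S W') →
              0 < margin d S W → ∀ h, IsClassifier d (harmonicLink ω) W h →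
                errorProb P h ≤ marginBound C R (capacity ψ W) (margin d S W) n δ ∧
                marginBound C R (capacity ψ W) (margin d S W) n δ < ⊤) := by
  have hK0 : (0 : ℝ) < K := by exact_mod_cast (zero_lt_two.trans_le hK)
  refine ⟨K ^ 2 * (23 * (22 + 4 * K)), by positivity, ?_⟩
  intro D d X Θ H _ _ _ _ _ _ φ ψ hφ hd P _ c R hP n hn δ hδ0 hδ
  obtain ⟨G, hG, hGδ, hGS⟩ :=
    exists_nearestPrototype_margin_bound (one_le_two.trans hK) hn hφ hd P hP hδ0 hδ
  -- The event `G` refers only to distances, so the same one serves every link.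
  refine ⟨fun κ hκ => ⟨G, hG, hGδ, fun S hS W hW hγ h hh => ?_⟩,
    fun ω hω => ⟨G, hG, hGδ, fun S hS W hW _ hγ h hh => ⟨?_, ?_⟩⟩⟩
  · exact hGS S hS W hW hγ h (hh.dist_le hκ)
  · exact hGS S hS W hW hγ h (hh.dist_le (strictAnti_harmonicLink hω))
  · have hR0 : 0 ≤ R := by
      obtain ⟨z, -, hz⟩ := hP.exists
      exact (norm_nonneg _).trans hz
    rw [marginBound_eq_ofReal (by positivity) hR0 (show 0 ≤ capacity ψ W from Real.sqrt_nonneg _) hγ hn]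
    exact ENNReal.ofReal_lt_top
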